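/- Let $p\in(1,\infty)\setminus\{2\}$, let $(X,\mu)$ be a $\sigma$-finite measure space such that the complex Banach space $E=L^p(X,\mu)$ is separable, and let $\mathcal B(E)$ carry, besides the operator norm, its weak* topology as the dual of $E'\widehat\otimes E$, that is, the coarsest topology making all functionals $T\mapsto\sum_i\langle\xi_i,T\eta_i\rangle$ with $\xi_i\in E'$, $\eta_i\in E$, $\sum_i\|\xi_i\|\|\eta_i\|<\infty$ continuous. Let $A\subseteq\mathcal B(E)$ be a weak* closed subalgebra containing the identity operator. Let $G$ be a countable discrete group and let $\alpha$ be a weak* continuous isometric action of $G$ on $A$: a homomorphism $t\mapsto\alpha_t$ from $G$ to the group of algebra automorphisms of $A$ such that each $\alpha_t$ is isometric and weak*-to-weak* continuous. On $\ell^p(G,E)$ put $(\pi(a)\xi)(s)=\alpha_{s^{-1}}(a)(\xi(s))$ for $a\in A$ and $(\lambda(t)\xi)(s)=\xi(t^{-1}s)$ for $t\in G$. Let $W^*_p(G,A,\alpha)$ be the weak* closure in $\mathcal B(\ell^p(G,E))$ of the algebra generated by the operators $\sum_{t}\pi(f(t))\lambda(t)$, where $f:G\to A$ is finitely supported. For a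 unital Banach algebra $B$, an element $a\in B$ is called hermitian if $w(a)\in\mathbb R$ for every continuous linear functional $w$ on $B$ with $\|w\|=w(1)=1$, and the $C^*$-core of $B$ is $\mathrm{core}(B)=B_h+iB_h$, where $B_h$ is the set of hermitian elements of $B$. Then the canonical embedding $a\mapsto\pi(a)$ is an isometric unital homomorphism from $A$ into $W^*_p(G,A,\alpha)$, and it identifies the $C^*$-core of $A$ with that of $W^*_p(G,A,\alpha)$: $$\pi(\mathrm{core}(A))=\mathrm{core}(W^*_p(G,A,\alpha)).$$ -/

import Mathlib

open scoped ENNReal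

noncomputable section

namespace LpCrossed

/-! ### The weak* topology of `B(E)` -/

section WeakStar

variable (E : Type*) [NormedAddCommGroup E] [NormedSpace ℂ E]

/-- Representing sequences of the elements `∑ i, ξ i ⊗ η i` of the projective tensor product of the
dual `E'` with `E`: the series of the products `‖ξ i‖ * ‖η i‖` converges. -/
structure NuclearSeries where
  /-- the functionals -/
  ξ : ℕ → (E →L[ℂ] ℂ)
  /-- the vectors -/
  η : ℕ → E
  summable : Summable fun i => ‖ξ i‖ * ‖η i‖

variable {E}

/-- The pairing `⟨T, ∑ i, ξ i ⊗ η i⟩ = ∑ i, ξ i (T (η i))`. -/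
def NuclearSeries.pair (ω : NuclearSeries E) (T : E →L[ℂ] E) : ℂ :=
  ∑' i, ω.ξ i (T (ω.η i))

variable (E) in
/-- The weak* topology on `B(E)`, as the dual of the projective tensor product of `E'` and `E`:
the coarsest topology for which all the functionals `T ↦ ⟨T, ω⟩` are continuous.
It is not an instance, since `B(E)` carries its norm topology. -/
@[reducible]
def weakStar : TopologicalSpace (E →L[ℂ] E) :=
  TopologicalSpace.induced (fun T (ω : NuclearSeries E) => ω.pair T) Pi.topologicalSpace

theorem NuclearSeries.summable_pair (ω : NuclearSeries E) (T : E →L[ℂ] E) :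
    Summable fun i => ω.ξ i (T (ω.η i)) := by
  refine Summable.of_norm_bounded (ω.summable.mul_left ‖T‖) fun i => ?_
  calc ‖ω.ξ i (T (ω.η i))‖ ≤ ‖ω.ξ i‖ * (‖T‖ * ‖ω.η i‖) :=
        (ω.ξ i).le_opNorm_of_le (T.le_opNorm _)
    _ = ‖T‖ * (‖ω.ξ i‖ * ‖ω.η i‖) := by ring

theorem NuclearSeries.pair_add (ω : NuclearSeries E) (S T : E →L[ℂ] E) :
    ω.pair (S + T) = ω.pair S + ω.pair T := by
  unfold NuclearSeries.pair
  rw [← (ω.summable_pair S).tsum_add (ω.summable_pair T)]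
  simp

/-- The series `∑ i, (ξ i ∘ R) ⊗ η i`. -/
def NuclearSeries.compLeft (ω : NuclearSeries E) (R : E →L[ℂ] E) : NuclearSeries E where
  ξ i := (ω.ξ i).comp R
  η := ω.η
  summable := by
    refine Summable.of_nonneg_of_le (fun i => by positivity) (fun i => ?_)
      (ω.summable.mul_left ‖R‖)
    calc ‖(ω.ξ i).comp R‖ * ‖ω.η i‖ ≤ (‖ω.ξ i‖ * ‖R‖) * ‖ω.η i‖ := by
          gcongr
          exact ContinuousLinearMap.opNorm_comp_le _ _
      _ = ‖R‖ * (‖ω.ξ i‖ * ‖ω.η i‖) := by ring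

/-- The series `∑ i, ξ i ⊗ R (η i)`. -/
def NuclearSeries.compRight (ω : NuclearSeries E) (R : E →L[ℂ] E) : NuclearSeries E where
  ξ := ω.ξ
  η i := R (ω.η i)
  summable := by
    refine Summable.of_nonneg_of_le (fun i => by positivity) (fun i => ?_)
      (ω.summable.mul_left ‖R‖)
    calc ‖ω.ξ i‖ * ‖R (ω.η i)‖ ≤ ‖ω.ξ i‖ * (‖R‖ * ‖ω.η i‖) := by
          gcongr
          exact R.le_opNorm _
      _ = ‖R‖ * (‖ω.ξ i‖ * ‖ω.η i‖) := by ring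

/-- Addition on `B(E)` is weak* continuous and multiplication is separately weak* continuous. -/
theorem isSemitopologicalSemiring_weakStar :
    @IsSemitopologicalSemiring (E →L[ℂ] E) (weakStar E) _ := by
  let _ : TopologicalSpace (E →L[ℂ] E) := weakStar E
  have hp : ∀ ω : NuclearSeries E, Continuous fun T : E →L[ℂ] E => ω.pair T := fun ω =>
    by
    have h0 : Continuous fun (T : E →L[ℂ] E) (ω : NuclearSeries E) => ω.pair T :=
      continuous_induced_dom
    exact (continuous_apply ω).comp h0
  refine @IsSemitopologicalSemiring.mk _ _ _ ⟨?_⟩ (@SeparatelyContinuousMul.mk _ _ _ ?_ ?_)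
  · refine continuous_induced_rng.2 (continuous_pi fun ω => ?_)
    have h : Continuous fun x : (E →L[ℂ] E) × (E →L[ℂ] E) => ω.pair x.1 + ω.pair x.2 :=
      ((hp ω).comp continuous_fst).add ((hp ω).comp continuous_snd)
    exact h.congr fun x => (ω.pair_add x.1 x.2).symm
  · intro R
    exact continuous_induced_rng.2 (continuous_pi fun ω => hp (ω.compLeft R))
  · intro R
    exact continuous_induced_rng.2 (continuous_pi fun ω => hp (ω.compRight R))

/-- The weak* closure of a subalgebra of `B(E)`; its underlying set is the closure of the
underlying set in the topology `weakStar E`. -/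
def weakStarClosure (S : Subalgebra ℂ (E →L[ℂ] E)) : Subalgebra ℂ (E →L[ℂ] E) :=
  @Subalgebra.topologicalClosure ℂ _ (E →L[ℂ] E) _ (weakStar E) _
    isSemitopologicalSemiring_weakStar S

theorem coe_weakStarClosure (S : Subalgebra ℂ (E →L[ℂ] E)) :
    (weakStarClosure S : Set (E →L[ℂ] E)) = @closure _ (weakStar E) (S : Set (E →L[ℂ] E)) :=
  rfl

end WeakStar

/-! ### Numerical range, hermitian elements, `C*`-core -/

section Core

variable {B : Type*} [NormedRing B] [NormedAlgebra ℂ B]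

/-- The numerical range of `a`: the values at `a` of the continuous linear functionals `w` with
`‖w‖ = w 1 = 1`. -/
def numericalRange (a : B) : Set ℂ :=
  {z | ∃ w : B →L[ℂ] ℂ, ‖w‖ = 1 ∧ w 1 = 1 ∧ w a = z}

/-- Hermitian elements: those with real numerical range. -/
def IsHermitianElement (a : B) : Prop :=
  ∀ z ∈ numericalRange a, z.im = 0

variable (B) in
/-- The `C*`-core of `B`: the set of all `h + i k` with `h` and `k` hermitian. -/
def core : Set B :=
  {x | ∃ h k : B, IsHermitianElement h ∧ IsHermitianElement k ∧ x = h + Complex.I • k}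

end Core

/-! ### Operators on `l^p(G, E)` -/

section Operators

variable {E : Type*} [NormedAddCommGroup E]
variable {G : Type*} (p : ℝ≥0∞) [Fact (1 ≤ p)]

theorem memℓp_comp_equiv (e : G ≃ G) (ξ : lp (fun _ : G => E) p) :
    Memℓp (fun s => ξ (e s)) p := by
  rcases p.trichotomy with h0 | h | h
  · exact absurd h0 (zero_lt_one.trans_le (Fact.out : 1 ≤ p)).ne'
  · subst h
    have hξ := memℓp_infty_iff.1 (lp.memℓp ξ)
    exact memℓp_infty (hξ.mono (Set.range_comp_subset_range e fun s => ‖ξ s‖))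
  · exact memℓp_gen (((lp.memℓp ξ).summable h).comp_injective e.injective)

theorem norm_comp_equiv (e : G ≃ G) (ξ : lp (fun _ : G => E) p) :
    ‖(⟨fun s => ξ (e s), memℓp_comp_equiv p e ξ⟩ : lp (fun _ : G => E) p)‖ = ‖ξ‖ := by
  rcases p.trichotomy with h0 | h | h
  · exact absurd h0 (zero_lt_one.trans_le (Fact.out : 1 ≤ p)).ne'
  · subst h
    rw [lp.norm_eq_ciSup, lp.norm_eq_ciSup]
    exact e.iSup_comp (g := fun s => ‖ξ s‖)
  · rw [lp.norm_eq_tsum_rpow h, lp.norm_eq_tsum_rpow h]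
    congr 1
    exact e.tsum_eq fun s => ‖ξ s‖ ^ p.toReal
variable [NormedSpace ℂ E]

/-- The bounded operator `(ξ s)ₛ ↦ (T s (ξ s))ₛ` on `l^p(G, E)` given by a uniformly bounded
family of operators on `E`. -/
def diagOp (T : G → E →L[ℂ] E) (C : ℝ) (hT : ∀ s, ‖T s‖ ≤ C) :
    lp (fun _ : G => E) p →L[ℂ] lp (fun _ : G => E) p :=
  have hle : ∀ (ξ : lp (fun _ : G => E) p) (s : G), ‖T s (ξ s)‖ ≤ ‖((C : ℂ) • ξ) s‖ :=
    fun ξ s => by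
      rw [lp.coeFn_smul, Pi.smul_apply, norm_smul, Complex.norm_real]
      exact (T s).le_of_opNorm_le ((hT s).trans (le_abs_self C)) _
  LinearMap.mkContinuous
    { toFun := fun ξ => ⟨fun s => T s (ξ s), (lp.memℓp ((C : ℂ) • ξ)).mono' (hle ξ)⟩
      map_add' := fun ξ ζ => by ext s; exact map_add (T s) _ _
      map_smul' := fun c ξ => by ext s; exact map_smul (T s) c _ } |C|
    fun ξ => by
      have hp0 : p ≠ 0 := (zero_lt_one.trans_le Fact.out).ne'
      have h := lp.norm_mono hp0
        (x := (⟨fun s => T s (ξ s), (lp.memℓp ((C : ℂ) • ξ)).mono' (hle ξ)⟩ :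
          lp (fun _ : G => E) p)) (y := (C : ℂ) • ξ) (hle ξ)
      rw [norm_smul, Complex.norm_real] at h
      exact h

@[simp]
theorem diagOp_apply (T : G → E →L[ℂ] E) (C : ℝ) (hT : ∀ s, ‖T s‖ ≤ C)
    (ξ : lp (fun _ : G => E) p) (s : G) : diagOp p T C hT ξ s = T s (ξ s) :=
  rfl

variable (E) in
/-- The left translation operator: `(leftTranslation E p t ξ) s = ξ (t⁻¹ * s)`. -/
def leftTranslation [Group G] (t : G) :
    lp (fun _ : G => E) p →L[ℂ] lp (fun _ : G => E) p :=
  LinearMap.mkContinuous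
    { toFun := fun ξ =>
        ⟨fun s => ξ (t⁻¹ * s), memℓp_comp_equiv p (Equiv.mulLeft t⁻¹) ξ⟩
      map_add' := fun _ _ => rfl
      map_smul' := fun _ _ => rfl } 1
    fun ξ => by
      rw [one_mul]
      exact (norm_comp_equiv p (Equiv.mulLeft t⁻¹) ξ).le

@[simp]
theorem leftTranslation_apply [Group G] (t : G) (ξ : lp (fun _ : G => E) p) (s : G) :
    leftTranslation E p t ξ s = ξ (t⁻¹ * s) :=
  rfl

end Operators

/-! ### Weak* continuous isometric actions and crossed products -/

section CrossedProduct

variable {E : Type*} [NormedAddCommGroup E] [NormedSpace ℂ E]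

/-- A weak* continuous isometric action of the discrete group `G` on `A ⊆ B(E)`: a homomorphism
from `G` to the isometric algebra automorphisms of `A`, each of which is continuous for the weak*
topology of `A` (the one induced from `B(E)`). The group is discrete, so that the
maps `t ↦ α t a` are automatically continuous. -/
structure WeakStarAction (G : Type*) [Group G] (A : Subalgebra ℂ (E →L[ℂ] E)) where
  /-- the homomorphism to the automorphisms -/
  toAut : G →* (A ≃ₐ[ℂ] A)
  norm_map : ∀ (t : G) (a : A), ‖toAut t a‖ = ‖a‖
  weakStar_continuous : ∀ t : G,
    @Continuous A A ((weakStar E).induced Subtype.val) ((weakStar E).induced Subtype.val)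
      (toAut t)

variable {G : Type*} [Group G] {A : Subalgebra ℂ (E →L[ℂ] E)}
variable (p : ℝ≥0∞) [Fact (1 ≤ p)] (α : WeakStarAction G A)

/-- The representation `(π a ξ) s = α_{s⁻¹}(a) (ξ s)` of `A` on `l^p(G, E)`. -/
def regularRep : A →ₐ[ℂ] (lp (fun _ : G => E) p →L[ℂ] lp (fun _ : G => E) p) where
  toFun a := diagOp p (fun s => (α.toAut s⁻¹ a : E →L[ℂ] E)) ‖a‖ fun s => (α.norm_map s⁻¹ a).le
  map_one' := by ext ξ s; simp
  map_mul' a b := by ext ξ s; simp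
  map_zero' := by ext ξ s; simp
  map_add' a b := by ext ξ s; simp
  commutes' c := by
    ext ξ s
    simp [Algebra.algebraMap_eq_smul_one]

theorem regularRep_apply (a : A) (ξ : lp (fun _ : G => E) p) (s : G) :
    regularRep p α a ξ s = (α.toAut s⁻¹ a : E →L[ℂ] E) (ξ s) :=
  rfl

/-- The integrated form `∑ t, π (f t) λ(t)` of a finitely supported function `f : G → A`. -/
def integratedForm (f : G →₀ A) : lp (fun _ : G => E) p →L[ℂ] lp (fun _ : G => E) p :=
  f.sum fun t a => regularRep p α a * leftTranslation E p t

/-- The weak* closed `L^p`-operator crossed product: the weak* closure in `B(l^p(G, E))` of the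
algebra generated by the operators `integratedForm p α f`. -/
def crossedProduct :
    Subalgebra ℂ (lp (fun _ : G => E) p →L[ℂ] lp (fun _ : G => E) p) :=
  weakStarClosure (Algebra.adjoin ℂ (Set.range (integratedForm p α)))

theorem regularRep_mem_crossedProduct (a : A) : regularRep p α a ∈ crossedProduct p α := by
  have h : integratedForm p α (Finsupp.single 1 a) = regularRep p α a := by
    have h1 : leftTranslation E p (1 : G) = 1 := by
      ext ξ s
      simp
    rw [integratedForm, Finsupp.sum_single_index (by simp), h1, mul_one]
  have h2 : regularRep p α a ∈
      (Algebra.adjoin ℂ (Set.range (integratedForm p α)) :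
        Set (lp (fun _ : G => E) p →L[ℂ] lp (fun _ : G => E) p)) :=
    Algebra.subset_adjoin ⟨_, h⟩
  exact @subset_closure _ (weakStar _) _ _ h2

/-- The canonical embedding `a ↦ π a` of `A` into the crossed product. -/
def canonicalEmbedding : A →ₐ[ℂ] crossedProduct p α :=
  (regularRep p α).codRestrict (crossedProduct p α) (regularRep_mem_crossedProduct p α)

end CrossedProduct

end LpCrossed

end

/-!
The proof works for an arbitrary Banach space `E`; only the `l^p`-sum over `G` matters.

Write an operator `T` on `l^p(G, E)` as a matrix `T_{s,t}` (`entry`). On the algebra generated by the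
integrated forms, `T_{s,t} = α_{s⁻¹}(b (s t⁻¹))` for some family `b : G → A`. The coefficient `b r` is
the entry `T_{1,r⁻¹}`, the entries are weak* continuous functions of `T`, `A` is weak* closed and the
`α_t` are weak* continuous, so this description survives in the weak* closure
(`mem_covariantOperators_of_mem_crossedProduct`). Hence a block diagonal element `T` of the crossed
product is `π (b 1)` (`exists_regularRep_eq_of_entry_eq_zero`).

A hermitian element `h` of the crossed product is block diagonal
(`entry_eq_zero_of_isHermitianElement`). Let `φ`, `ψ` be norming functionals of unit vectors `x`, `y`
of `E`, and let `s ≠ t`. If `v` has entries `x` at `s` and `z y` at `t`, then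
`f ζ = φ (ζ s) + |z| ^ (p - 2) * conj z * ψ (ζ t)` attains its norm at `v` by Hölder's inequality, so
that `f (h v)` is real. The diagonal entries contribute real numbers. What remains says that the
imaginary part of `z * φ (h_{s,t} y) + |z| ^ (p - 2) * conj z * ψ (h_{t,s} x)` vanishes for all `z`.
The two terms have different degrees of homogeneity in `|z|` as `p ≠ 2`, so both vanish; with `y`
proportional to `h_{t,s} x` this gives `h_{t,s} x = 0`.

Finally, `π` is isometric, and the compression to the coordinate `1` is a contractive left inverse of
`π` from the crossed product to `A`. Both are unital, so `a` is hermitian if and only if `π a` is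
(`isHermitianElement_canonicalEmbedding_iff`).
-/

namespace LpCrossed

open Filter Topology

/-! ### Convergence in the weak* topology -/

section WeakStar

variable {E : Type*} [NormedAddCommGroup E] [NormedSpace ℂ E]

theorem tendsto_weakStar_iff {ι : Type*} {l : Filter ι} {f : ι → E →L[ℂ] E} {T : E →L[ℂ] E} :
    Tendsto f l (@nhds _ (weakStar E) T) ↔
      ∀ ω : NuclearSeries E, Tendsto (fun i => ω.pair (f i)) l (𝓝 (ω.pair T)) := by
  let _ : TopologicalSpace (E →L[ℂ] E) := weakStar E
  have h : IsInducing fun (T : E →L[ℂ] E) (ω : NuclearSeries E) => ω.pair T := ⟨rfl⟩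
  exact h.tendsto_nhds_iff.trans tendsto_pi_nhds

theorem exists_filter_of_mem_weakStarClosure {S : Subalgebra ℂ (E →L[ℂ] E)} {T : E →L[ℂ] E}
    (hT : T ∈ weakStarClosure S) :
    ∃ l : Filter S, l.NeBot ∧ Tendsto (fun x : S => (x : E →L[ℂ] E)) l
      (@nhds _ (weakStar E) T) := by
  let _ : TopologicalSpace (E →L[ℂ] E) := weakStar E
  exact ⟨comap (↑) (𝓝 T), mem_closure_iff_comap_neBot.1 hT, tendsto_comap⟩

/-- The elementary tensor `φ ⊗ x`. -/
noncomputable def NuclearSeries.elementary (φ : E →L[ℂ] ℂ) (x : E) : NuclearSeries E where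
  ξ := Pi.single 0 φ
  η := Pi.single 0 x
  summable := summable_of_ne_finset_zero (s := {0}) fun i hi => by
    simp [Pi.single_eq_of_ne (Finset.notMem_singleton.1 hi)]

theorem NuclearSeries.elementary_pair (φ : E →L[ℂ] ℂ) (x : E) (T : E →L[ℂ] E) :
    (NuclearSeries.elementary φ x).pair T = φ (T x) := by
  unfold NuclearSeries.pair
  rw [tsum_eq_single 0 fun i hi => by simp [elementary, Pi.single_eq_of_ne hi]]
  simp [elementary]

theorem weakStar_tendsto_unique {ι : Type*} {l : Filter ι} [l.NeBot] {f : ι → E →L[ℂ] E}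
    {S T : E →L[ℂ] E} (hS : Tendsto f l (@nhds _ (weakStar E) S))
    (hT : Tendsto f l (@nhds _ (weakStar E) T)) : S = T := by
  ext x
  refine (SeparatingDual.eq_iff_forall_dual_eq (R := ℂ)).2 fun φ => ?_
  have h := tendsto_nhds_unique (tendsto_weakStar_iff.1 hS (.elementary φ x))
    (tendsto_weakStar_iff.1 hT (.elementary φ x))
  simpa only [NuclearSeries.elementary_pair] using h

end WeakStar

/-! ### Matrix entries of operators on `l^p(G, E)` -/

section Entries

variable {E : Type*} [NormedAddCommGroup E] [NormedSpace ℂ E]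
variable {G : Type*} (p : ℝ≥0∞) [Fact (1 ≤ p)]

open scoped Classical in
/-- The matrix entry `T_{s,t} ∈ B(E)` of an operator `T` on `l^p(G, E)`: the inclusion of `E` as the
coordinate `t`, followed by `T` and the projection to the coordinate `s`. -/
noncomputable def entry (s t : G) (T : lp (fun _ : G => E) p →L[ℂ] lp (fun _ : G => E) p) :
    E →L[ℂ] E :=
  (lp.evalCLM ℂ (fun _ : G => E) p s).comp
    (T.comp (lp.singleContinuousLinearMap ℂ (fun _ : G => E) p t))

open scoped Classical in
theorem entry_apply (s t : G) (T : lp (fun _ : G => E) p →L[ℂ] lp (fun _ : G => E) p) (x : E) :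
    entry p s t T x = T (lp.single p t x) s :=
  rfl

theorem entry_add (s t : G) (S T : lp (fun _ : G => E) p →L[ℂ] lp (fun _ : G => E) p) :
    entry p s t (S + T) = entry p s t S + entry p s t T :=
  rfl

theorem entry_smul (s t : G) (c : ℂ) (T : lp (fun _ : G => E) p →L[ℂ] lp (fun _ : G => E) p) :
    entry p s t (c • T) = c • entry p s t T :=
  rfl

theorem norm_entry_le (s t : G) (T : lp (fun _ : G => E) p →L[ℂ] lp (fun _ : G => E) p) :
    ‖entry p s t T‖ ≤ ‖T‖ := by
  classical
  have hp : 0 < p := zero_lt_one.trans_le Fact.out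
  refine ContinuousLinearMap.opNorm_le_bound _ (norm_nonneg _) fun x => ?_
  rw [entry_apply]
  calc ‖T (lp.single p t x) s‖ ≤ ‖T (lp.single p t x)‖ := lp.norm_apply_le_norm hp.ne' _ _
    _ ≤ ‖T‖ * ‖lp.single (E := fun _ : G => E) p t x‖ := T.le_opNorm _
    _ = ‖T‖ * ‖x‖ := by rw [lp.norm_single hp]

theorem tendsto_entry {ι : Type*} {l : Filter ι}
    {f : ι → lp (fun _ : G => E) p →L[ℂ] lp (fun _ : G => E) p}
    {T : lp (fun _ : G => E) p →L[ℂ] lp (fun _ : G => E) p}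
    (hf : Tendsto f l (@nhds _ (weakStar _) T)) (s t : G) :
    Tendsto (fun i => entry p s t (f i)) l (@nhds _ (weakStar E) (entry p s t T)) := by
  classical
  rw [tendsto_weakStar_iff] at hf ⊢
  intro ω
  have hp : 0 < p := zero_lt_one.trans_le Fact.out
  -- the image of `∑ i, ξ i ⊗ η i` under the preadjoint of the map taking `T` to `T_{s,t}`
  let ω' : NuclearSeries (lp (fun _ : G => E) p) :=
    { ξ := fun i => (ω.ξ i).comp (lp.evalCLM ℂ (fun _ : G => E) p s)
      η := fun i => lp.single p t (ω.η i)
      summable := by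
        refine Summable.of_nonneg_of_le (fun i => by positivity) (fun i => ?_) ω.summable
        rw [lp.norm_single hp]
        gcongr
        refine ContinuousLinearMap.opNorm_le_bound _ (norm_nonneg _) fun ζ => ?_
        exact (ω.ξ i).le_opNorm_of_le (lp.norm_apply_le_norm hp.ne' ζ s) }
  exact hf ω'

theorem norm_diagOp_le (T : G → E →L[ℂ] E) (C : ℝ) (hT : ∀ s, ‖T s‖ ≤ C) :
    ‖diagOp p T C hT‖ ≤ |C| := by
  unfold diagOp
  exact LinearMap.mkContinuous_norm_le _ (abs_nonneg C) _

/-- An operator on `l^p(G, E)`, where `p < ∞`, is determined by its matrix entries. -/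
theorem ext_entry (hp : p ≠ ∞) {S T : lp (fun _ : G => E) p →L[ℂ] lp (fun _ : G => E) p}
    (h : ∀ s t, entry p s t S = entry p s t T) : S = T := by
  classical
  ext1 ξ
  have hS := (lp.hasSum_single hp ξ).mapL S
  have hT := (lp.hasSum_single hp ξ).mapL T
  have hST : (fun t => S (lp.single p t (ξ t))) = fun t => T (lp.single p t (ξ t)) := by
    funext t
    ext s
    rw [← entry_apply, ← entry_apply, h]
  rw [hST] at hS
  exact hS.unique hT

end Entries

/-! ### Fourier coefficients in the crossed product -/

section Fourier

variable {E : Type*} [NormedAddCommGroup E] [NormedSpace ℂ E]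
variable {G : Type*} [Group G] {A : Subalgebra ℂ (E →L[ℂ] E)}
variable (p : ℝ≥0∞) [Fact (1 ≤ p)] (α : WeakStarAction G A)

theorem leftTranslation_mul (s t : G) :
    leftTranslation E p (s * t) = leftTranslation E p s * leftTranslation E p t := by
  ext ξ r
  simp [mul_assoc]

theorem leftTranslation_mul_regularRep (t : G) (a : A) :
    leftTranslation E p t * regularRep p α a =
      regularRep p α (α.toAut t a) * leftTranslation E p t := by
  ext ξ s
  simp [regularRep_apply]

theorem leftTranslation_one : leftTranslation E p (1 : G) = 1 := by
  ext ξ s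
  simp

theorem entry_regularRep_mul_leftTranslation (a : A) (r s t : G) [Decidable (s * t⁻¹ = r)] :
    entry p s t (regularRep p α a * leftTranslation E p r) =
      ((α.toAut s⁻¹ (if s * t⁻¹ = r then a else 0) : A) : E →L[ℂ] E) := by
  classical
  ext x
  rw [entry_apply, mul_apply_eq_comp, regularRep_apply, leftTranslation_apply,
    lp.single_apply]
  by_cases h : s * t⁻¹ = r
  · have ht : r⁻¹ * s = t := by rw [← h]; group
    rw [if_pos h, ht, Pi.single_eq_same]
  · have ht : r⁻¹ * s ≠ t := fun ht => h (by rw [← ht]; group)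
    rw [if_neg h, Pi.single_eq_of_ne ht]
    simp

theorem entry_regularRep_of_ne (a : A) {s t : G} (h : s ≠ t) :
    entry p s t (regularRep p α a) = 0 := by
  classical
  have h1 := entry_regularRep_mul_leftTranslation p α a 1 s t
  rw [leftTranslation_one, mul_one, if_neg fun h' => h (mul_inv_eq_one.1 h')] at h1
  simpa using h1

theorem entry_regularRep_self (a : A) (s : G) :
    entry p s s (regularRep p α a) = (α.toAut s⁻¹ a : E →L[ℂ] E) := by
  classical
  have h1 := entry_regularRep_mul_leftTranslation p α a 1 s s
  rwa [leftTranslation_one, mul_one, if_pos (mul_inv_cancel s)] at h1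

/-- The subspace of all operators that have matrix entries `T_{s,t} = α_{s⁻¹}(b (s t⁻¹))` for some
family `b` in `A`, as the formal series `∑ r, π (b r) λ(r)` does. -/
def covariantOperators :
    Submodule ℂ (lp (fun _ : G => E) p →L[ℂ] lp (fun _ : G => E) p) where
  carrier := {T | ∃ b : G → A, ∀ s t, entry p s t T = (α.toAut s⁻¹ (b (s * t⁻¹)) : E →L[ℂ] E)}
  zero_mem' := ⟨0, fun s t => by simp; rfl⟩
  add_mem' := by
    rintro S T ⟨b, hb⟩ ⟨c, hc⟩
    exact ⟨b + c, fun s t => by simp [entry_add, hb, hc]⟩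
  smul_mem' := by
    rintro z T ⟨b, hb⟩
    exact ⟨z • b, fun s t => by simp [entry_smul, hb]⟩

theorem adjoin_integratedForm_le_span :
    Subalgebra.toSubmodule (Algebra.adjoin ℂ (Set.range (integratedForm p α))) ≤
      Submodule.span ℂ (Set.range fun x : A × G =>
        regularRep p α x.1 * leftTranslation E p x.2) := by
  intro T hT
  refine Algebra.adjoin_induction (p := fun T _ => T ∈ Submodule.span ℂ (Set.range
    fun x : A × G => regularRep p α x.1 * leftTranslation E p x.2)) ?_ ?_ ?_ ?_ hT
  · rintro _ ⟨f, rfl⟩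
    exact Submodule.sum_mem _ fun t _ => Submodule.subset_span ⟨(f t, t), rfl⟩
  · intro c
    rw [Algebra.algebraMap_eq_smul_one]
    refine Submodule.smul_mem _ _ (Submodule.subset_span ⟨(1, 1), ?_⟩)
    simp [leftTranslation_one]
  · intro S T _ _ hS hT
    exact Submodule.add_mem _ hS hT
  · intro S T _ _ hS hT
    refine Submodule.span_induction₂ (p := fun S T _ _ => S * T ∈ Submodule.span ℂ (Set.range
      fun x : A × G => regularRep p α x.1 * leftTranslation E p x.2)) ?_ ?_ ?_ ?_ ?_ ?_ ?_ hS hT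
    · rintro _ _ ⟨⟨a, s⟩, rfl⟩ ⟨⟨b, t⟩, rfl⟩
      refine Submodule.subset_span ⟨(a * α.toAut s b, s * t), ?_⟩
      simp only [map_mul, leftTranslation_mul]
      rw [mul_assoc, mul_assoc, ← mul_assoc (leftTranslation E p s),
        leftTranslation_mul_regularRep, mul_assoc]
    · intro T _
      rw [zero_mul]
      exact Submodule.zero_mem _
    · intro T _
      rw [mul_zero]
      exact Submodule.zero_mem _
    · intro S S' T _ _ _ h h'
      rw [add_mul]
      exact Submodule.add_mem _ h h'
    · intro S T T' _ _ _ h h'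
      rw [mul_add]
      exact Submodule.add_mem _ h h'
    · intro c S T _ _ h
      rw [smul_mul_assoc]
      exact Submodule.smul_mem _ _ h
    · intro c S T _ _ h
      rw [mul_smul_comm]
      exact Submodule.smul_mem _ _ h

theorem span_le_covariantOperators :
    Submodule.span ℂ (Set.range fun x : A × G =>
      regularRep p α x.1 * leftTranslation E p x.2) ≤ covariantOperators p α := by
  classical
  refine Submodule.span_le.2 ?_
  rintro _ ⟨⟨a, r⟩, rfl⟩
  exact ⟨fun u => if u = r then a else 0, fun s t =>
    entry_regularRep_mul_leftTranslation p α a r s t⟩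

/-- The elements of the crossed product have Fourier coefficients in `A`. The coefficient at `r`
can be read off from the entry at `(1, r⁻¹)`, so the condition passes to weak* limits because `A` is
weak* closed and the `α_t` are weak* continuous. -/
theorem mem_covariantOperators_of_mem_crossedProduct
    (hA : @IsClosed _ (weakStar E) (A : Set (E →L[ℂ] E)))
    {T : lp (fun _ : G => E) p →L[ℂ] lp (fun _ : G => E) p} (hT : T ∈ crossedProduct p α) :
    T ∈ covariantOperators p α := by
  obtain ⟨l, hl, hlT⟩ := exists_filter_of_mem_weakStarClosure hT
  choose b hb using fun S : Algebra.adjoin ℂ (Set.range (integratedForm p α)) =>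
    span_le_covariantOperators p α (adjoin_integratedForm_le_span p α S.2)
  have hb1 : ∀ S r, entry p 1 r⁻¹ S.1 = (b S r : E →L[ℂ] E) := fun S r => by
    rw [hb]
    simp
  have hlim : ∀ r, Tendsto (fun S => (b S r : E →L[ℂ] E)) l
      (@nhds _ (weakStar E) (entry p 1 r⁻¹ T)) := fun r => by
    simpa only [hb1] using tendsto_entry p hlT 1 r⁻¹
  have hmem : ∀ r, entry p 1 r⁻¹ T ∈ A := fun r =>
    @IsClosed.mem_of_tendsto _ (weakStar E) _ _ _ _ _ hl hA (hlim r)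
      (Eventually.of_forall fun S => (b S r).2)
  refine ⟨fun r => ⟨_, hmem r⟩, fun s t => ?_⟩
  refine weakStar_tendsto_unique (tendsto_entry p hlT s t) ?_
  simp only [hb]
  let _ : TopologicalSpace (E →L[ℂ] E) := weakStar E
  have hval : IsInducing (Subtype.val : A → E →L[ℂ] E) := ⟨rfl⟩
  have hα := ((α.weakStar_continuous s⁻¹).tendsto ⟨_, hmem (s * t⁻¹)⟩).comp
    (hval.tendsto_nhds_iff.2 (hlim (s * t⁻¹)))
  exact hval.tendsto_nhds_iff.1 hα

/-- A block diagonal element of the crossed product lies in the image of `A`. -/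
theorem exists_regularRep_eq_of_entry_eq_zero (hp : p ≠ ∞)
    (hA : @IsClosed _ (weakStar E) (A : Set (E →L[ℂ] E)))
    {T : lp (fun _ : G => E) p →L[ℂ] lp (fun _ : G => E) p} (hT : T ∈ crossedProduct p α)
    (hdiag : ∀ s t, s ≠ t → entry p s t T = 0) : ∃ a : A, regularRep p α a = T := by
  obtain ⟨b, hb⟩ := mem_covariantOperators_of_mem_crossedProduct p α hA hT
  refine ⟨b 1, ext_entry p hp fun s t => ?_⟩
  by_cases h : s = t
  · subst h
    rw [entry_regularRep_self, hb, mul_inv_cancel]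
  · rw [entry_regularRep_of_ne p α _ h, hdiag s t h]

end Fourier

/-! ### Hermitian elements of algebras of operators -/

section Hermitian

variable {F : Type*} [NormedAddCommGroup F] [NormedSpace ℂ F] {W : Subalgebra ℂ (F →L[ℂ] F)}

/-- A spatial form of hermiticity: the functional `T ↦ f (T v) / f v` is a state if `f` attains its
norm at `v`. -/
theorem IsHermitianElement.im_apply_eq_zero {h : W} (hh : IsHermitianElement h)
    {f : F →L[ℂ] ℂ} {v : F} {N : ℝ} (hN : 0 < N) (hf : ‖f‖ * ‖v‖ ≤ N) (hfv : f v = N) :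
    (f ((h : F →L[ℂ] F) v)).im = 0 := by
  have hNC : (N : ℂ) ≠ 0 := Complex.ofReal_ne_zero.2 hN.ne'
  let w : W →L[ℂ] ℂ := LinearMap.mkContinuous
    { toFun := fun T => (N : ℂ)⁻¹ * f ((T : F →L[ℂ] F) v)
      map_add' := fun S T => by simp [mul_add]
      map_smul' := fun c T => by simp; ring } 1 fun T => by
    have h1 : ‖f ((T : F →L[ℂ] F) v)‖ ≤ ‖f‖ * (‖T‖ * ‖v‖) :=
      f.le_opNorm_of_le ((T : F →L[ℂ] F).le_opNorm v)
    change ‖(N : ℂ)⁻¹ * f ((T : F →L[ℂ] F) v)‖ ≤ _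
    rw [norm_mul, norm_inv, Complex.norm_real, Real.norm_of_nonneg hN.le, one_mul,
      inv_mul_le_iff₀ hN]
    calc ‖f ((T : F →L[ℂ] F) v)‖ ≤ ‖f‖ * (‖T‖ * ‖v‖) := h1
      _ = ‖f‖ * ‖v‖ * ‖T‖ := by ring
      _ ≤ N * ‖T‖ := mul_le_mul_of_nonneg_right hf (norm_nonneg _)
  have hw_apply : ∀ T : W, w T = (N : ℂ)⁻¹ * f ((T : F →L[ℂ] F) v) := fun _ => rfl
  have hw1 : w 1 = 1 := by
    rw [hw_apply]
    simp [hfv, hNC]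
  have hw : ‖w‖ = 1 := by
    refine le_antisymm (LinearMap.mkContinuous_norm_le _ zero_le_one _) ?_
    have h1 : ‖(1 : W)‖ ≤ 1 := ContinuousLinearMap.norm_id_le
    have h2 := w.le_opNorm 1
    rw [hw1, norm_one] at h2
    exact h2.trans (mul_le_of_le_one_right (norm_nonneg _) h1)
  have := hh _ ⟨w, hw, hw1, rfl⟩
  rw [hw_apply, ← Complex.ofReal_inv, Complex.im_ofReal_mul] at this
  exact (mul_eq_zero.1 this).resolve_left (inv_ne_zero hN.ne')

/-- Contractive unital linear maps between normed algebras preserve hermitian elements. -/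
theorem IsHermitianElement.of_contractive {B C : Type*} [NormedRing B] [NormedAlgebra ℂ B]
    [NormedRing C] [NormedAlgebra ℂ C] (Φ : B →L[ℂ] C) (hΦ : ‖Φ‖ ≤ 1) (hΦ1 : Φ 1 = 1)
    (hB : ‖(1 : B)‖ ≤ 1) {a : B} (ha : IsHermitianElement a) : IsHermitianElement (Φ a) := by
  rintro _ ⟨w, hw, hw1, rfl⟩
  refine ha _ ⟨w.comp Φ, le_antisymm ?_ ?_, by simp [hΦ1, hw1], rfl⟩
  · calc ‖w.comp Φ‖ ≤ ‖w‖ * ‖Φ‖ := ContinuousLinearMap.opNorm_comp_le _ _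
      _ ≤ 1 := by rw [hw, one_mul]; exact hΦ
  · have h2 := (w.comp Φ).le_opNorm 1
    rw [ContinuousLinearMap.comp_apply, hΦ1, hw1, norm_one] at h2
    exact h2.trans (mul_le_of_le_one_right (norm_nonneg _) hB)

end Hermitian

/-! ### Hermitian operators on `l^p(G, E)` are block diagonal -/

section Diagonal

variable {E : Type*} [NormedAddCommGroup E] [NormedSpace ℂ E] {G : Type*} {p : ℝ≥0∞}
  [Fact (1 ≤ p)] {W : Subalgebra ℂ (lp (fun _ : G => E) p →L[ℂ] lp (fun _ : G => E) p)}

theorem im_entry_self_eq_zero {h : W} (hh : IsHermitianElement h) (s : G) {x : E} {φ : E →L[ℂ] ℂ}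
    (hx : ‖x‖ = 1) (hφ : ‖φ‖ = 1) (hφx : φ x = 1) : (φ (entry p s s h.1 x)).im = 0 := by
  classical
  have hp : 0 < p := zero_lt_one.trans_le Fact.out
  refine hh.im_apply_eq_zero (f := φ.comp (lp.evalCLM ℂ (fun _ : G => E) p s))
    (v := lp.single p s x) one_pos ?_ ?_
  · rw [lp.norm_single hp, hx, mul_one]
    refine ContinuousLinearMap.opNorm_le_bound _ zero_le_one fun ζ => ?_
    exact (φ.le_opNorm_of_le (lp.norm_apply_le_norm hp.ne' ζ s)).trans_eq (by rw [hφ])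
  · change φ (lp.single (E := fun _ : G => E) p s x s) = _
    rw [lp.single_apply_self, hφx, Complex.ofReal_one]

/-- Hermiticity tested on the vector with entries `x` at `s` and `z y` at `t`, with `z = r c` and
`|c| = 1`, whose norming functional is `ζ ↦ φ (ζ s) + r ^ (p - 1) * conj c * ψ (ζ t)`. -/
theorem im_entry_add_eq_zero (hp_one : 1 < p) (hp_top : p ≠ ∞) {h : W} (hh : IsHermitianElement h)
    {s t : G} (hst : s ≠ t) {x y : E} {φ ψ : E →L[ℂ] ℂ}
    (hx : ‖x‖ = 1) (hφ : ‖φ‖ = 1) (hφx : φ x = 1) (hy : ‖y‖ = 1) (hψ : ‖ψ‖ = 1) (hψy : ψ y = 1)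
    {r : ℝ} (hr : 0 < r) {c : ℂ} (hc : ‖c‖ = 1) :
    r * (c * φ (entry p s t h.1 y)).im +
      r ^ (p.toReal - 1) * (star c * ψ (entry p t s h.1 x)).im = 0 := by
  classical
  have hp : 0 < p := zero_lt_one.trans hp_one
  have hpR : 1 < p.toReal := by
    simpa using (ENNReal.toReal_lt_toReal ENNReal.one_ne_top hp_top).2 hp_one
  have hpR0 : 0 < p.toReal := zero_lt_one.trans hpR
  set P := p.toReal
  set R : ℝ := r ^ (P - 1) with hR
  have hR0 : 0 < R := Real.rpow_pos_of_pos hr _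
  have hrR : r * R = r ^ P := by
    rw [hR, Real.rpow_sub_one hr.ne', mul_div_cancel₀ _ hr.ne']
  have hcc : star c * c = 1 := by
    have := Complex.conj_mul' c
    rw [hc] at this
    simpa using this
  set N : ℝ := 1 + r ^ P with hN
  have hN0 : 0 < N := by positivity
  have hconj : P.HolderConjugate P.conjExponent := Real.HolderConjugate.conjExponent hpR
  have hRq : R ^ P.conjExponent = r ^ P := by
    rw [hR, ← Real.rpow_mul hr.le, Real.conjExponent,
      mul_div_cancel₀ _ (sub_pos.2 hpR).ne']
  let f : lp (fun _ : G => E) p →L[ℂ] ℂ :=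
    φ.comp (lp.evalCLM ℂ (fun _ : G => E) p s) +
      ((R : ℂ) * star c) • ψ.comp (lp.evalCLM ℂ (fun _ : G => E) p t)
  have hf_apply : ∀ ζ, f ζ = φ (ζ s) + R * star c * ψ (ζ t) := fun _ => rfl
  have hf : ‖f‖ ≤ N ^ (1 / P.conjExponent) := by
    refine ContinuousLinearMap.opNorm_le_bound _ (by positivity) fun ζ => ?_
    have h1 : ‖f ζ‖ ≤ ‖ζ s‖ + ‖ζ t‖ * R := by
      rw [hf_apply]
      refine (norm_add_le _ _).trans (add_le_add ?_ ?_)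
      · simpa [hφ] using φ.le_opNorm (ζ s)
      · rw [norm_mul, norm_mul, norm_star, hc, Complex.norm_real, Real.norm_of_nonneg hR0.le,
          mul_one, mul_comm]
        gcongr
        simpa [hψ] using ψ.le_opNorm (ζ t)
    have h2 := Real.inner_le_Lp_mul_Lq {s, t} (fun i => ‖ζ i‖) (fun i => if i = s then 1 else R)
      hconj
    rw [Finset.sum_pair hst, Finset.sum_pair hst (f := fun i => |if i = s then 1 else R| ^ _),
      if_pos rfl, if_neg hst.symm, mul_one, abs_one, Real.one_rpow, abs_of_pos hR0, hRq,
      ← hN] at h2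
    simp only [abs_norm] at h2
    have h3 : (∑ i ∈ {s, t}, ‖ζ i‖ ^ P) ^ (1 / P) ≤ ‖ζ‖ := by
      rw [one_div, Real.rpow_inv_le_iff_of_pos (by positivity) (norm_nonneg _) hpR0]
      exact lp.sum_rpow_le_norm_rpow hpR0 ζ {s, t}
    calc ‖f ζ‖ ≤ _ := h1
      _ ≤ _ := h2
      _ ≤ ‖ζ‖ * N ^ (1 / P.conjExponent) := by gcongr
      _ = _ := mul_comm _ _
  let v : lp (fun _ : G => E) p := lp.single p s x + lp.single p t (((r : ℂ) * c) • y)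
  have hv : ‖v‖ ^ P = N := by
    have h1 := lp.norm_sum_single (E := fun _ : G => E) hpR0
      (fun i => if i = s then x else ((r : ℂ) * c) • y) {s, t}
    rw [Finset.sum_pair hst, Finset.sum_pair hst, if_pos rfl, if_neg hst.symm, norm_smul, norm_mul,
      Complex.norm_real, hc, hx, hy, Real.norm_of_nonneg hr.le, mul_one, mul_one,
      Real.one_rpow] at h1
    exact h1
  have hv' : ‖v‖ = N ^ (1 / P) := by
    rw [← hv, one_div, Real.rpow_rpow_inv (norm_nonneg _) hpR0.ne']
  have hfv_le : ‖f‖ * ‖v‖ ≤ N := by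
    calc ‖f‖ * ‖v‖ ≤ N ^ (1 / P.conjExponent) * N ^ (1 / P) := by rw [hv']; gcongr
      _ = N := by
        rw [← Real.rpow_add hN0, one_div, one_div, add_comm, hconj.inv_add_inv_eq_one,
          Real.rpow_one]
  have hvs : v s = x := by
    rw [lp.coeFn_add, Pi.add_apply, lp.single_apply_self, lp.single_apply_ne p t _ hst, add_zero]
  have hvt : v t = ((r : ℂ) * c) • y := by
    rw [lp.coeFn_add, Pi.add_apply, lp.single_apply_self, lp.single_apply_ne p s _ hst.symm,
      zero_add]
  have hfv : f v = N := by
    rw [hf_apply, hvs, hvt, map_smul, hφx, hψy, smul_eq_mul, mul_one, hN, ← hrR]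
    push_cast
    linear_combination (r : ℂ) * R * hcc
  have key := hh.im_apply_eq_zero hN0 hfv_le hfv
  have hs := im_entry_self_eq_zero hh s hx hφ hφx
  have ht := im_entry_self_eq_zero hh t hy hψ hψy
  have hv_eq : v = lp.single p s x + ((r : ℂ) * c) • lp.single p t y := by
    rw [← lp.single_smul]
  have hexp : f ((h : lp (fun _ : G => E) p →L[ℂ] lp (fun _ : G => E) p) v) =
      φ (entry p s s h.1 x) + ((r * R : ℝ) : ℂ) * ψ (entry p t t h.1 y) +
        ((r : ℂ) * (c * φ (entry p s t h.1 y)) + (R : ℂ) * (star c * ψ (entry p t s h.1 x))) := by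
    rw [hf_apply, hv_eq, map_add, map_smul, lp.coeFn_add, lp.coeFn_smul, Pi.add_apply,
      Pi.add_apply, Pi.smul_apply, Pi.smul_apply]
    simp only [← entry_apply, map_add, map_smul, smul_eq_mul]
    push_cast
    linear_combination ((r : ℂ) * R * ψ (entry p t t h.1 y)) * hcc
  rw [hexp, Complex.add_im, Complex.add_im, Complex.add_im, Complex.im_ofReal_mul,
    Complex.im_ofReal_mul, Complex.im_ofReal_mul, hs, ht, mul_zero, add_zero, zero_add] at key
  exact key

/-- For `p ≠ 2` the hermitian operators on `l^p(G, E)` are block diagonal: the two off-diagonal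
terms have different degrees of homogeneity, `1` and `p - 1`, in the size of the test vector. -/
theorem entry_eq_zero_of_isHermitianElement (hp_one : 1 < p) (hp_top : p ≠ ∞) (hp_two : p ≠ 2)
    {h : W} (hh : IsHermitianElement h) {s t : G} (hst : s ≠ t) : entry p t s h.1 = 0 := by
  -- it is enough to consider the unit vectors
  suffices H : ∀ x : E, ‖x‖ = 1 → entry p t s h.1 x = 0 by
    ext x
    by_cases hx : x = 0
    · simp [hx]
    have h1 := H (((‖x‖⁻¹ : ℝ) : ℂ) • x) (by
      rw [norm_smul, Complex.norm_real, norm_inv, norm_norm,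
        inv_mul_cancel₀ (norm_ne_zero_iff.2 hx)])
    rw [map_smul, smul_eq_zero] at h1
    refine h1.resolve_left ?_
    exact Complex.ofReal_ne_zero.2 (inv_ne_zero (norm_ne_zero_iff.2 hx))
  intro x hx
  by_contra hu
  set u : E := entry p t s h.1 x with hu_def
  have hu' : ‖u‖ ≠ 0 := norm_ne_zero_iff.2 hu
  obtain ⟨φ, hφ, hφx⟩ := exists_dual_vector ℂ x (by rw [hx]; exact one_ne_zero)
  obtain ⟨ψ, hψ, hψu⟩ := exists_dual_vector ℂ u hu'
  rw [hx] at hφx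
  have hy : ‖((‖u‖⁻¹ : ℝ) : ℂ) • u‖ = 1 := by
    rw [norm_smul, Complex.norm_real, norm_inv, norm_norm, inv_mul_cancel₀ hu']
  have hψy : ψ (((‖u‖⁻¹ : ℝ) : ℂ) • u) = 1 := by
    rw [map_smul, hψu, smul_eq_mul]
    simp [hu]
  -- the unimodular factor `-i` makes the second off-diagonal term `i ‖u‖`
  have key : ∀ r : ℝ, 0 < r → _ := fun r hr =>
    im_entry_add_eq_zero hp_one hp_top hh hst hx hφ (by simpa using hφx) hy hψ hψy hr
      (c := -Complex.I) (by simp)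
  have h1 := key 1 one_pos
  have h2 := key 2 two_pos
  have him : (star (-Complex.I) * ψ (entry p t s h.1 x)).im = ‖u‖ := by
    rw [← hu_def, hψu]
    simp
  rw [him] at h1 h2
  rw [Real.one_rpow] at h1
  have h3 : (2 : ℝ) ^ (p.toReal - 1) = 2 ^ (1 : ℝ) := by
    rw [Real.rpow_one]
    refine mul_right_cancel₀ hu' ?_
    linarith
  have h4 : p.toReal - 1 = 1 :=
    (Real.rpow_right_inj two_pos (by norm_num)).1 h3
  refine hp_two ((ENNReal.toReal_eq_toReal_iff' hp_top ENNReal.ofNat_ne_top).1 ?_)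
  rw [ENNReal.toReal_ofNat]
  linarith

end Diagonal

/-! ### The core of the crossed product -/

section Core

variable {E : Type*} [NormedAddCommGroup E] [NormedSpace ℂ E]
variable {G : Type*} [Group G] {A : Subalgebra ℂ (E →L[ℂ] E)}
variable {p : ℝ≥0∞} [Fact (1 ≤ p)] (α : WeakStarAction G A)

theorem norm_canonicalEmbedding (a : A) : ‖canonicalEmbedding p α a‖ = ‖a‖ := by
  change ‖regularRep p α a‖ = ‖a‖
  refine le_antisymm ?_ ?_
  · exact (norm_diagOp_le p (fun s => (α.toAut s⁻¹ a : E →L[ℂ] E)) ‖a‖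
      fun s => (α.norm_map s⁻¹ a).le).trans_eq (abs_norm a)
  · calc ‖a‖ = ‖entry p 1 1 (regularRep p α a)‖ := by
          rw [entry_regularRep_self, inv_one, map_one]
          rfl
      _ ≤ _ := norm_entry_le p 1 1 _

theorem isHermitianElement_canonicalEmbedding_iff
    (hA : @IsClosed _ (weakStar E) (A : Set (E →L[ℂ] E))) (a : A) :
    IsHermitianElement (canonicalEmbedding p α a) ↔ IsHermitianElement a := by
  constructor
  · intro h
    -- the compression to the coordinate `1` is a contractive left inverse of the embedding
    have hmem : ∀ T : crossedProduct p α, entry p 1 1 T.1 ∈ A := fun T => by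
      obtain ⟨b, hb⟩ := mem_covariantOperators_of_mem_crossedProduct p α hA T.2
      rw [hb]
      exact Subtype.property _
    let Φ : crossedProduct p α →L[ℂ] A := LinearMap.mkContinuous
      { toFun := fun T => ⟨entry p 1 1 T.1, hmem T⟩
        map_add' := fun _ _ => rfl
        map_smul' := fun _ _ => rfl } 1 fun T => by
      rw [one_mul]
      exact norm_entry_le p 1 1 _
    have hΦ : ∀ a, Φ (canonicalEmbedding p α a) = a := fun a => by
      refine Subtype.ext ((entry_regularRep_self p α a 1).trans ?_)
      simp
    have h1 := h.of_contractive Φ (LinearMap.mkContinuous_norm_le _ zero_le_one _)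
      (by simpa using hΦ 1) ContinuousLinearMap.norm_id_le
    rwa [hΦ] at h1
  · intro h
    let Φ : A →L[ℂ] crossedProduct p α :=
      (canonicalEmbedding p α).toLinearMap.mkContinuous 1 fun a => by
        rw [one_mul]
        exact (norm_canonicalEmbedding α a).le
    exact h.of_contractive Φ (LinearMap.mkContinuous_norm_le _ zero_le_one _)
      (map_one (canonicalEmbedding p α)) ContinuousLinearMap.norm_id_le

theorem exists_canonicalEmbedding_eq_of_isHermitianElement (hp_one : 1 < p) (hp_top : p ≠ ∞)
    (hp_two : p ≠ 2) (hA : @IsClosed _ (weakStar E) (A : Set (E →L[ℂ] E)))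
    {h : crossedProduct p α} (hh : IsHermitianElement h) :
    ∃ a : A, IsHermitianElement a ∧ canonicalEmbedding p α a = h := by
  obtain ⟨a, ha⟩ := exists_regularRep_eq_of_entry_eq_zero p α hp_top hA h.2 fun s t hst =>
    entry_eq_zero_of_isHermitianElement hp_one hp_top hp_two hh hst.symm
  have ha' : canonicalEmbedding p α a = h := Subtype.ext ha
  refine ⟨a, (isHermitianElement_canonicalEmbedding_iff (p := p) α hA a).1 ?_, ha'⟩
  rwa [ha']

theorem image_core (hp_one : 1 < p) (hp_top : p ≠ ∞) (hp_two : p ≠ 2)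
    (hA : @IsClosed _ (weakStar E) (A : Set (E →L[ℂ] E))) :
    canonicalEmbedding p α '' core A = core (crossedProduct p α) := by
  ext x
  constructor
  · rintro ⟨_, ⟨a, b, ha, hb, rfl⟩, rfl⟩
    exact ⟨_, _, (isHermitianElement_canonicalEmbedding_iff α hA a).2 ha,
      (isHermitianElement_canonicalEmbedding_iff α hA b).2 hb, by simp⟩
  · rintro ⟨h, k, hh, hk, rfl⟩
    obtain ⟨a, ha, rfl⟩ :=
      exists_canonicalEmbedding_eq_of_isHermitianElement α hp_one hp_top hp_two hA hh
    obtain ⟨b, hb, rfl⟩ :=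
      exists_canonicalEmbedding_eq_of_isHermitianElement α hp_one hp_top hp_two hA hk
    exact ⟨_, ⟨a, b, ha, hb, rfl⟩, by simp⟩

end Core

end LpCrossed

theorem proposition4p4 {p : ℝ≥0∞} [Fact (1 ≤ p)] (hp_one : 1 < p) (hp_top : p ≠ ∞) (hp_two : p ≠ 2)
    {X : Type*} [MeasurableSpace X] (μ : MeasureTheory.Measure X) [MeasureTheory.SigmaFinite μ]
    [TopologicalSpace.SeparableSpace (MeasureTheory.Lp ℂ p μ)]
    {G : Type*} [Group G] [Countable G]
    (A : Subalgebra ℂ (MeasureTheory.Lp ℂ p μ →L[ℂ] MeasureTheory.Lp ℂ p μ))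
    (hA : @IsClosed _ (LpCrossed.weakStar (MeasureTheory.Lp ℂ p μ))
      (A : Set (MeasureTheory.Lp ℂ p μ →L[ℂ] MeasureTheory.Lp ℂ p μ)))
    (α : LpCrossed.WeakStarAction G A) :
    (∀ a : A, ‖LpCrossed.canonicalEmbedding p α a‖ = ‖a‖) ∧
      LpCrossed.canonicalEmbedding p α '' LpCrossed.core A =
        LpCrossed.core (LpCrossed.crossedProduct p α) := by
  exact ⟨LpCrossed.norm_canonicalEmbedding α, LpCrossed.image_core α hp_one hp_top hp_two hA⟩
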